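/- A pattern (or permutation) of length $k$ is a permutation $q=q_1q_2\cdots q_k$ of $\{1,\dots,k\}$. A copy of $q$ in a permutation $p=p_1\cdots p_n$ is a choice of positions $i_1<\cdots<i_k$ such that $p_{i_a}<p_{i_b}$ if and only if $q_a<q_b$, for all $1\le a,b\le k$; $p$ avoids $q$ if it contains no copy of $q$. Let $S_{n,132}(q)$ denote the total number of copies of $q$ in all $132$-avoiding permutations of length $n$. For patterns $q$ of length $k$ and $t$ of length $m$, let $q\oplus t$ be the pattern of length $k+m$ with $(q\oplus t)_i=q_i$ for $i\le k$ and $(q\oplus t)_i=t_{i-k}+k$ for $i>k$, and let $q\ominus t$ be the pattern of length $k+m$ with $(q\ominus t)_i=q_i+m$ for $i\le k$ and $(q\ominus t)_i=t_{i-k}$ for $i>k$. Let $i_u=12\cdots u$ be the increasing pattern of length $u$. **Theorem.** Let $q$ and $t$ be non-empty patterns that each end in their largest entry. Then for all integers $u\ge 0$ and $n\ge 0$, $$S_{n,132}\bigl((q\ominus t)\oplus i_u\bigr)=S_{n,132}\bigl((q\oplus i_u)\ominus t\bigr).$$ -/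

import Mathlib

namespace PatternCount

/-- A permutation (or pattern) of length `k` is `q : Equiv.Perm (Fin k)`; its entries, read from
left to right, are `q 0, q 1, …, q (k - 1)`, with values and positions counted from `0`.
`IsCopy p q f` says that the entries of `p` at the positions `f 0 < f 1 < ⋯ < f (k - 1)` are in the
same relative order as the entries of `q`. -/
def IsCopy {n k : ℕ} (p : Equiv.Perm (Fin n)) (q : Equiv.Perm (Fin k)) (f : Fin k ↪o Fin n) :
    Prop :=
  ∀ a b : Fin k, p (f a) < p (f b) ↔ q a < q b

instance {n k : ℕ} (p : Equiv.Perm (Fin n)) (q : Equiv.Perm (Fin k)) (f : Fin k ↪o Fin n) :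
    Decidable (IsCopy p q f) := by
  unfold IsCopy; infer_instance

/-- The number of copies of the pattern `q` in the permutation `p`. -/
noncomputable def copies {n k : ℕ} (p : Equiv.Perm (Fin n)) (q : Equiv.Perm (Fin k)) : ℕ :=
  Nat.card {f : Fin k ↪o Fin n // IsCopy p q f}

/-- `p` avoids the pattern `r`: it contains no copy of `r`. -/
def Avoids {n k : ℕ} (p : Equiv.Perm (Fin n)) (r : Equiv.Perm (Fin k)) : Prop :=
  ¬ ∃ f : Fin k ↪o Fin n, IsCopy p r f

open Classical in
/-- `S_{n,r}(q)`: the total number of copies of `q` in all `r`-avoiding permutations of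
length `n`. -/
noncomputable def S (n : ℕ) {l k : ℕ} (r : Equiv.Perm (Fin l)) (q : Equiv.Perm (Fin k)) : ℕ :=
  ∑ p : Equiv.Perm (Fin n) with Avoids p r, copies p q

/-- The pattern 132. -/
def pat132 : Equiv.Perm (Fin 3) := Equiv.swap 1 2

/-- The increasing pattern `12⋯u`. -/
def incr (u : ℕ) : Equiv.Perm (Fin u) := Equiv.refl (Fin u)

/-- The direct sum `q ⊕ t`: the entries of `q`, followed by the entries of `t` increased by the
length of `q`. -/
def oplus {k m : ℕ} (q : Equiv.Perm (Fin k)) (t : Equiv.Perm (Fin m)) :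
    Equiv.Perm (Fin (k + m)) :=
  finSumFinEquiv.symm.trans ((Equiv.sumCongr q t).trans finSumFinEquiv)

/-- The skew sum `q ⊖ t`: the entries of `q` increased by the length of `t`, followed by the
entries of `t`. -/
def ominus {k m : ℕ} (q : Equiv.Perm (Fin k)) (t : Equiv.Perm (Fin m)) :
    Equiv.Perm (Fin (k + m)) :=
  finSumFinEquiv.symm.trans ((Equiv.sumCongr q t).trans
    ((Equiv.sumComm (Fin k) (Fin m)).trans
      (finSumFinEquiv.trans (finCongr (Nat.add_comm m k)))))

theorem oplus_left {k m : ℕ} (q : Equiv.Perm (Fin k)) (t : Equiv.Perm (Fin m)) (i : Fin k) :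
    (oplus q t (Fin.castAdd m i) : ℕ) = q i := by
  simp [oplus]

theorem oplus_right {k m : ℕ} (q : Equiv.Perm (Fin k)) (t : Equiv.Perm (Fin m)) (i : Fin m) :
    (oplus q t (Fin.natAdd k i) : ℕ) = t i + k := by
  simp [oplus, Nat.add_comm]

theorem ominus_left {k m : ℕ} (q : Equiv.Perm (Fin k)) (t : Equiv.Perm (Fin m)) (i : Fin k) :
    (ominus q t (Fin.castAdd m i) : ℕ) = q i + m := by
  simp [ominus, Nat.add_comm]

theorem ominus_right {k m : ℕ} (q : Equiv.Perm (Fin k)) (t : Equiv.Perm (Fin m)) (i : Fin m) :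
    (ominus q t (Fin.natAdd k i) : ℕ) = t i := by
  simp [ominus]

/-- The entry in the last position of `q` is its largest entry. -/
def EndsInLargest {k : ℕ} (q : Equiv.Perm (Fin k)) : Prop :=
  ∀ i : Fin k, (i : ℕ) + 1 = k → ∀ j : Fin k, q j ≤ q i

end PatternCount

/-! A non-empty permutation avoids 132 exactly when it is `(L ⊕ 1) ⊖ R` with `L`, `R` avoiding 132:
no entry before the maximum may lie below one after it. Counting copies across this decomposition
gives equations for the generating functions F. Let C be that of the avoiders, so C = 1 + XC².

A copy of `Q ⊕ 1` lies in `L ⊕ 1` or in `R`, whence (1 - 2XC) F(Q ⊕ 1) = XC F(Q)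
(`genFun_oplus_one`, iterated in `genFun_oplus_incr`). A copy of `q ⊖ t` may also be divided between
its two blocks, and nowhere else because each block ends in its maximum; this yields C²(1 - 2XC) F(q
⊖ t) = F(q) F(t) (`genFun_ominus_eq_mul`).

Hence either side of the theorem, multiplied by C²(1 - 2XC)^(u+1), becomes (XC)^u F(q) F(t), and the
factor cancels in ℤ⟦X⟧. -/

open Equiv

namespace PatternCount

/-! ### Copies divided by a cut -/

/-- The number of copies of `Q` in `w` of which exactly the first `c` entries are taken from the
first `a` positions of `w`. -/
noncomputable def cutCopies {n k : ℕ} (a : ℕ) (w : Perm (Fin n)) (Q : Perm (Fin k)) (c : ℕ) : ℕ :=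
  Nat.card {f : Fin k ↪o Fin n // IsCopy w Q f ∧ ∀ i, (f i : ℕ) < a ↔ (i : ℕ) < c}

theorem exists_cut {k : ℕ} (s : Fin k → Prop) (hs : ∀ i j, i ≤ j → s j → s i) :
    ∃ c < k + 1, ∀ i : Fin k, s i ↔ (i : ℕ) < c := by
  classical
  by_cases h : ∃ c, ∃ hc : c < k, ¬ s ⟨c, hc⟩
  · obtain ⟨hc, hn⟩ := Nat.find_spec h
    refine ⟨Nat.find h, by omega, fun i => ⟨fun hi => ?_, fun hi => ?_⟩⟩
    · by_contra hlt
      exact hn (hs _ i (by simpa [Fin.le_def] using hlt) hi)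
    · have := Nat.find_min h hi
      by_contra hsi
      exact this ⟨i.2, hsi⟩
  · push Not at h
    exact ⟨k, by omega, fun i => ⟨fun _ => i.2, fun _ => h i i.2⟩⟩

/-- Positions of a copy increase, so those below `a` form an initial segment of a unique length `c`.
-/
theorem copies_eq_sum_cutCopies {n k : ℕ} (a : ℕ) (w : Perm (Fin n)) (Q : Perm (Fin k)) :
    copies w Q = ∑ c ∈ Finset.range (k + 1), cutCopies a w Q c := by
  rw [← Fin.sum_univ_eq_sum_range (cutCopies a w Q)]
  unfold cutCopies copies
  rw [← Nat.card_sigma]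
  refine (Nat.card_congr (Equiv.ofBijective
    (fun x : (Σ c : Fin (k + 1), {f : Fin k ↪o Fin n //
      IsCopy w Q f ∧ ∀ i, (f i : ℕ) < a ↔ (i : ℕ) < (c : ℕ)}) =>
      (⟨x.2.1, x.2.2.1⟩ : {f : Fin k ↪o Fin n // IsCopy w Q f})) ⟨?_, ?_⟩)).symm
  · rintro ⟨c, f, hf⟩ ⟨c', f', hf'⟩ h
    obtain rfl : f = f' := congrArg Subtype.val h
    obtain rfl : c = c' := by
      have key : ∀ i : Fin k, (i : ℕ) < c ↔ (i : ℕ) < c' := fun i =>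
        (hf.2 i).symm.trans (hf'.2 i)
      have := c.2
      have := c'.2
      ext
      rcases lt_trichotomy (c : ℕ) c' with h | h | h
      · have := key ⟨c, by omega⟩
        simp at this
        omega
      · exact h
      · have := key ⟨c', by omega⟩
        simp at this
        omega
    rfl
  · rintro ⟨f, hf⟩
    obtain ⟨c, hc, h⟩ := exists_cut (fun i => (f i : ℕ) < a) (fun i j hij hj =>
      lt_of_le_of_lt (Fin.le_def.1 (f.monotone hij)) hj)
    exact ⟨⟨⟨c, hc⟩, f, hf, h⟩, rfl⟩

theorem cutCopies_eq_zero {n k : ℕ} {a : ℕ} {w : Perm (Fin n)} {Q : Perm (Fin k)} {c : ℕ}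
    (h : ∀ f : Fin k ↪o Fin n, IsCopy w Q f → ¬ ∀ i, (f i : ℕ) < a ↔ (i : ℕ) < c) :
    cutCopies a w Q c = 0 := by
  unfold cutCopies
  rw [Nat.card_eq_zero]
  left
  exact ⟨fun ⟨f, hf, hc⟩ => h f hf hc⟩

/-- `P` and `R` are the patterns formed by the first `a` and the last `b` entries of `w`. -/
structure IsSplit {a b n : ℕ} (h : a + b = n) (w : Perm (Fin n)) (P : Perm (Fin a))
    (R : Perm (Fin b)) : Prop where
  left : ∀ x y, w (Fin.cast h (Fin.castAdd b x)) < w (Fin.cast h (Fin.castAdd b y)) ↔ P x < P y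
  right : ∀ x y, w (Fin.cast h (Fin.natAdd a x)) < w (Fin.cast h (Fin.natAdd a y)) ↔ R x < R y

theorem cutCopies_eq_mul {a b n c d k : ℕ} (h : a + b = n) (h' : c + d = k)
    {w : Perm (Fin n)} {P : Perm (Fin a)} {R : Perm (Fin b)}
    {Q : Perm (Fin k)} {q : Perm (Fin c)} {t : Perm (Fin d)}
    (hw : IsSplit h w P R) (hQ : IsSplit h' Q q t)
    (hx : ∀ x y i j, w (Fin.cast h (Fin.castAdd b x)) < w (Fin.cast h (Fin.natAdd a y)) ↔
      Q (Fin.cast h' (Fin.castAdd d i)) < Q (Fin.cast h' (Fin.natAdd c j))) :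
    cutCopies a w Q c = copies P q * copies R t := by
  subst h h'
  obtain ⟨hw1, hw2⟩ := hw
  obtain ⟨hQ1, hQ2⟩ := hQ
  simp only [Fin.cast_refl, id] at hw1 hw2 hQ1 hQ2 hx
  have hx' : ∀ x y i j, w (Fin.natAdd a y) < w (Fin.castAdd b x) ↔
      Q (Fin.natAdd c j) < Q (Fin.castAdd d i) := by
    intro x y i j
    have h1 : w (Fin.natAdd a y) ≠ w (Fin.castAdd b x) := fun e => by
      have := congrArg Fin.val (w.injective e)
      simp at this
      omega
    have h2 : Q (Fin.natAdd c j) ≠ Q (Fin.castAdd d i) := fun e => by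
      have := congrArg Fin.val (Q.injective e)
      simp at this
      omega
    rw [← h1.le_iff_lt, ← h2.le_iff_lt, ← not_lt, ← not_lt, hx x y i j]
  unfold cutCopies copies
  rw [← Nat.card_prod]
  have mono : ∀ (g : Fin c ↪o Fin a) (l : Fin d ↪o Fin b), StrictMono
      (Fin.addCases (fun i => Fin.castAdd b (g i)) (fun j => Fin.natAdd a (l j)) :
        Fin (c + d) → Fin (a + b)) := by
    intro g l i j
    refine Fin.addCases (fun i => ?_) (fun i => ?_) i <;>
    refine Fin.addCases (fun j => ?_) (fun j => ?_) j <;> intro hij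
    · rw [Fin.lt_def, Fin.val_castAdd, Fin.val_castAdd, ← Fin.lt_def] at hij
      simp only [Fin.addCases_left, Fin.lt_def, Fin.val_castAdd]
      exact g.strictMono hij
    · simp only [Fin.addCases_left, Fin.addCases_right, Fin.lt_def, Fin.val_castAdd, Fin.val_natAdd]
      omega
    · simp only [Fin.lt_def, Fin.val_castAdd, Fin.val_natAdd] at hij
      omega
    · simpa using hij
  refine (Nat.card_congr (Equiv.ofBijective
    (fun x : {g : Fin c ↪o Fin a // IsCopy P q g} × {l : Fin d ↪o Fin b // IsCopy R t l} =>
      (⟨OrderEmbedding.ofStrictMono _ (mono x.1.1 x.2.1), ?_, ?_⟩ :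
        {f : Fin (c + d) ↪o Fin (a + b) //
          IsCopy w Q f ∧ ∀ i, (f i : ℕ) < a ↔ (i : ℕ) < c})) ⟨?_, ?_⟩)).symm
  · obtain ⟨⟨g, hg⟩, ⟨l, hl⟩⟩ := x
    intro i j
    refine Fin.addCases (fun i => ?_) (fun i => ?_) i <;>
    refine Fin.addCases (fun j => ?_) (fun j => ?_) j
    · simpa [hw1, hQ1] using hg i j
    · simpa using hx _ _ _ _
    · simpa using hx' _ _ _ _
    · simpa [hw2, hQ2] using hl i j
  · intro i
    refine Fin.addCases (fun i => ?_) (fun i => ?_) i <;> simp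
  · rintro ⟨⟨g, hg⟩, ⟨l, hl⟩⟩ ⟨⟨g', hg'⟩, ⟨l', hl'⟩⟩ e
    have e1 := congrArg Subtype.val e
    have e2 : ∀ i, _ := fun i => DFunLike.congr_fun e1 i
    simp only [Prod.mk.injEq, Subtype.mk.injEq]
    constructor
    · ext i
      simpa using congrArg Fin.val (e2 (Fin.castAdd d i))
    · ext i
      simpa using congrArg Fin.val (e2 (Fin.natAdd c i))
  · rintro ⟨f, hf, hc⟩
    have h1 : ∀ i : Fin c, (f (Fin.castAdd d i) : ℕ) < a := fun i => by
      rw [hc]; simp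
    have h2 : ∀ i : Fin d, a ≤ (f (Fin.natAdd c i) : ℕ) := fun i => by
      rw [← not_lt, hc]; simp
    let g : Fin c ↪o Fin a := OrderEmbedding.ofStrictMono (fun i => ⟨f (Fin.castAdd d i), h1 i⟩)
      (fun i j hij => Fin.lt_def.1 (f.strictMono (Fin.lt_def.2 hij)))
    let l : Fin d ↪o Fin b := OrderEmbedding.ofStrictMono
      (fun i => ⟨f (Fin.natAdd c i) - a, by have := h2 i; omega⟩)
      (fun i j hij => by
        have : f (Fin.natAdd c i) < f (Fin.natAdd c j) := f.strictMono (by simpa using hij)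
        have := h2 i
        have := h2 j
        simp only [Fin.lt_def] at *
        omega)
    have hg : ∀ i, Fin.castAdd b (g i) = f (Fin.castAdd d i) := fun i => by
      rfl
    have hl : ∀ i, Fin.natAdd a (l i) = f (Fin.natAdd c i) := fun i => by
      ext; exact Nat.add_sub_cancel' (h2 i)
    refine ⟨⟨⟨g, fun i j => ?_⟩, ⟨l, fun i j => ?_⟩⟩, ?_⟩
    · rw [← hw1, hg, hg, hf, hQ1]
    · rw [← hw2, hl, hl, hf, hQ2]
    · ext i
      refine Fin.addCases (fun i => ?_) (fun i => ?_) i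
      · simpa using congrArg Fin.val (hg i)
      · simpa using congrArg Fin.val (hl i)

/-! ### Copies in direct and skew sums -/

theorem copies_zero {n : ℕ} (w : Perm (Fin n)) (e : Perm (Fin 0)) : copies w e = 1 := by
  unfold copies
  rw [Nat.card_eq_one_iff_unique]
  exact ⟨⟨fun f g => Subtype.ext (by ext i; exact i.elim0)⟩,
    ⟨⟨OrderEmbedding.ofStrictMono (fun i => i.elim0) (fun i => i.elim0), fun i => i.elim0⟩⟩⟩

theorem copies_one_one (w e : Perm (Fin 1)) : copies w e = 1 := by
  unfold copies
  rw [Nat.card_eq_one_iff_unique]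
  refine ⟨⟨fun f g => Subtype.ext (by ext i; simp)⟩, ⟨⟨RelEmbedding.refl _, fun i j => ?_⟩⟩⟩
  simp [Subsingleton.elim i j]

theorem isSplit_zero_left {k : ℕ} (Q : Perm (Fin k)) (e : Perm (Fin 0)) :
    IsSplit (Nat.zero_add k) Q e Q :=
  ⟨fun x => x.elim0, fun x y => by
    have : ∀ z : Fin k, Fin.cast (Nat.zero_add k) (Fin.natAdd 0 z) = z := fun z => by ext; simp
    rw [this, this]⟩

theorem isSplit_zero_right {k : ℕ} (Q : Perm (Fin k)) (e : Perm (Fin 0)) :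
    IsSplit (Nat.add_zero k) Q Q e :=
  ⟨fun _ _ => Iff.rfl, fun x => x.elim0⟩

theorem isSplit_ominus {a b : ℕ} (P : Perm (Fin a)) (R : Perm (Fin b)) :
    IsSplit rfl (ominus P R) P R :=
  ⟨fun x y => by
    rw [Fin.cast_refl, id, id, Fin.lt_def, ominus_left, ominus_left, Fin.lt_def]; try omega,
    fun x y => by rw [Fin.cast_refl, id, id, Fin.lt_def, ominus_right, ominus_right, Fin.lt_def]; try omega⟩

theorem isSplit_oplus {a b : ℕ} (P : Perm (Fin a)) (R : Perm (Fin b)) :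
    IsSplit rfl (oplus P R) P R :=
  ⟨fun x y => by
    rw [Fin.cast_refl, id, id, Fin.lt_def, oplus_left, oplus_left, Fin.lt_def]; try omega,
    fun x y => by rw [Fin.cast_refl, id, id, Fin.lt_def, oplus_right, oplus_right, Fin.lt_def]; try omega⟩

theorem ominus_lt {a b : ℕ} (P : Perm (Fin a)) (R : Perm (Fin b)) (x : Fin a) (y : Fin b) :
    ominus P R (Fin.natAdd a y) < ominus P R (Fin.castAdd b x) := by
  rw [Fin.lt_def, ominus_left, ominus_right]; omega

theorem lt_oplus {a b : ℕ} (P : Perm (Fin a)) (R : Perm (Fin b)) (x : Fin a) (y : Fin b) :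
    oplus P R (Fin.castAdd b x) < oplus P R (Fin.natAdd a y) := by
  rw [Fin.lt_def, oplus_left, oplus_right]; omega

theorem ominus_lt_of_lt_of_le {a b : ℕ} (P : Perm (Fin a)) (R : Perm (Fin b)) {x y : Fin (a + b)}
    (hx : (x : ℕ) < a) (hy : a ≤ (y : ℕ)) : ominus P R y < ominus P R x := by
  have := ominus_lt P R ⟨x, hx⟩ ⟨y - a, by omega⟩
  convert this using 2 <;> ext <;> simp; omega

theorem lt_oplus_of_lt_of_le {a b : ℕ} (P : Perm (Fin a)) (R : Perm (Fin b)) {x y : Fin (a + b)}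
    (hx : (x : ℕ) < a) (hy : a ≤ (y : ℕ)) : oplus P R x < oplus P R y := by
  have := lt_oplus P R ⟨x, hx⟩ ⟨y - a, by omega⟩
  convert this using 2 <;> ext <;> simp; omega

theorem cutCopies_zero {a b k : ℕ} {w : Perm (Fin (a + b))} {P : Perm (Fin a)} {R : Perm (Fin b)}
    (hw : IsSplit rfl w P R) (Q : Perm (Fin k)) : cutCopies a w Q 0 = copies R Q := by
  rw [cutCopies_eq_mul rfl (Nat.zero_add k) hw (isSplit_zero_left Q (Equiv.refl _))
    (fun _ _ i => i.elim0), copies_zero, one_mul]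

theorem cutCopies_self {a b k : ℕ} {w : Perm (Fin (a + b))} {P : Perm (Fin a)} {R : Perm (Fin b)}
    (hw : IsSplit rfl w P R) (Q : Perm (Fin k)) : cutCopies a w Q k = copies P Q := by
  rw [cutCopies_eq_mul rfl (Nat.add_zero k) hw (isSplit_zero_right Q (Equiv.refl _))
    (fun _ _ _ j => j.elim0), copies_zero, mul_one]

/-- A cut inside an interval of entries whose first entry does not exceed its last one is
impossible in a skew sum. -/
theorem cutCopies_ominus_eq_zero {a b k : ℕ} (P : Perm (Fin a)) (R : Perm (Fin b))
    {Q : Perm (Fin k)} {c : ℕ} {i j : Fin k} (hi : (i : ℕ) < c) (hj : c ≤ (j : ℕ))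
    (h : Q i ≤ Q j) : cutCopies a (ominus P R) Q c = 0 := by
  refine cutCopies_eq_zero fun f hf hc => ?_
  have := ominus_lt_of_lt_of_le P R ((hc i).2 hi) (not_lt.1 (mt (hc j).1 (not_lt.2 hj)))
  rw [hf] at this
  exact absurd this (not_lt.2 h)

/-- Every proper cut separates the first entry of `Q` from the last, so a copy lies entirely in one
summand. -/
theorem copies_ominus_of_le {a b k : ℕ} (P : Perm (Fin a)) (R : Perm (Fin b))
    {Q : Perm (Fin (k + 1))} (h : Q 0 ≤ Q (Fin.last k)) :
    copies (ominus P R) Q = copies P Q + copies R Q := by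
  rw [copies_eq_sum_cutCopies a, Finset.sum_range_succ, cutCopies_self (isSplit_ominus P R),
    Finset.sum_range_succ', cutCopies_zero (isSplit_ominus P R), Finset.sum_eq_zero, zero_add,
    add_comm]
  intro c hc
  rw [Finset.mem_range] at hc
  exact cutCopies_ominus_eq_zero P R (i := 0) (j := Fin.last k) (by simp) (by simpa using hc) h

/-- A proper cut other than the one between `q` and `t` separates the first and last entries of one
of these blocks, which is impossible. -/
theorem copies_ominus_ominus {a b k m : ℕ} (P : Perm (Fin a)) (R : Perm (Fin b))
    {q : Perm (Fin (k + 1))} {t : Perm (Fin (m + 1))} (hq : q 0 ≤ q (Fin.last k))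
    (ht : t 0 ≤ t (Fin.last m)) :
    copies (ominus P R) (ominus q t) = copies P (ominus q t) + copies R (ominus q t) +
      copies P q * copies R t := by
  have h1 : cutCopies a (ominus P R) (ominus q t) (k + 1) = copies P q * copies R t :=
    cutCopies_eq_mul rfl rfl (isSplit_ominus P R) (isSplit_ominus q t) fun x y i j =>
      iff_of_false (not_lt.2 (ominus_lt P R x y).le) (not_lt.2 (ominus_lt q t i j).le)
  -- Removing the cut 0 shifts the index by one, so the surviving cut `k + 1` appears as index `k`.
  rw [copies_eq_sum_cutCopies a, Finset.sum_range_succ, cutCopies_self (isSplit_ominus P R),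
    show ∑ c ∈ Finset.range (k + 1 + (m + 1)), cutCopies a (ominus P R) (ominus q t) c = _ from
      Finset.sum_range_succ' _ (k + 1 + m), cutCopies_zero (isSplit_ominus P R),
    Finset.sum_eq_single k, h1]
  · ring
  · intro c hc hck
    rw [Finset.mem_range] at hc
    rcases lt_or_gt_of_ne hck with h | h
    · refine cutCopies_ominus_eq_zero P R (i := Fin.castAdd (m + 1) 0)
        (j := Fin.castAdd (m + 1) (Fin.last k)) (by simp) (by simpa using h) ?_
      rw [Fin.le_def, ominus_left, ominus_left]
      exact Nat.add_le_add_right hq _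
    · refine cutCopies_ominus_eq_zero P R (i := Fin.natAdd (k + 1) 0)
        (j := Fin.natAdd (k + 1) (Fin.last m)) (by simpa using h) (by simp; omega) ?_
      simpa only [Fin.le_def, ominus_right] using ht
  · intro h
    simp at h
    omega

theorem cutCopies_eq_zero_of_add_one_lt {a k : ℕ} (w : Perm (Fin (a + 1))) (Q : Perm (Fin k))
    {c : ℕ} (h : c + 1 < k) : cutCopies a w Q c = 0 := by
  refine cutCopies_eq_zero fun f _ hc => ?_
  have h1 := hc ⟨c, by omega⟩
  have h2 := hc ⟨c + 1, h⟩
  have h3 : f ⟨c, by omega⟩ < f ⟨c + 1, h⟩ := f.strictMono (by simp [Fin.lt_def])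
  rw [Fin.lt_def] at h3
  simp at h1 h2
  omega

theorem copies_succ {a k : ℕ} {w : Perm (Fin (a + 1))} {L : Perm (Fin a)} {e : Perm (Fin 1)}
    (hw : IsSplit rfl w L e) (Q : Perm (Fin (k + 1))) :
    copies w Q = copies L Q + cutCopies a w Q k := by
  rw [copies_eq_sum_cutCopies a, Finset.sum_range_succ, cutCopies_self hw,
    Finset.sum_range_succ, Finset.sum_eq_zero, zero_add, add_comm]
  intro c hc
  exact cutCopies_eq_zero_of_add_one_lt w Q (by simpa using hc)

theorem copies_oplus_oplus {a k : ℕ} (L : Perm (Fin a)) (Q : Perm (Fin k)) :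
    copies (oplus L (incr 1)) (oplus Q (incr 1)) = copies L (oplus Q (incr 1)) + copies L Q := by
  rw [copies_succ (isSplit_oplus _ _), cutCopies_eq_mul rfl rfl (isSplit_oplus L (incr 1))
    (isSplit_oplus Q (incr 1)), copies_one_one, mul_one]
  exact fun x y i j => iff_of_true (lt_oplus _ _ x y) (lt_oplus _ _ i j)

/-- A copy using the final maximum would have its last entry above all others. -/
theorem copies_oplus_of_lt {a k : ℕ} (L : Perm (Fin a)) {Q : Perm (Fin (k + 1))} {i : Fin (k + 1)}
    (h : Q (Fin.last k) < Q i) : copies (oplus L (incr 1)) Q = copies L Q := by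
  rw [copies_succ (isSplit_oplus _ _), cutCopies_eq_zero, add_zero]
  intro f hf hc
  have hi : (i : ℕ) < k := by
    have : i ≠ Fin.last k := by rintro rfl; exact lt_irrefl _ h
    exact Fin.val_lt_last this
  have := lt_oplus_of_lt_of_le L (incr 1) ((hc i).2 hi)
    (not_lt.1 (mt (hc (Fin.last k)).1 (by simp)))
  rw [hf] at this
  exact absurd this (not_lt.2 h.le)

/-! ### Decomposition of 132-avoiding permutations -/

theorem exists_perm_lt_iff {n : ℕ} {α : Type*} [LinearOrder α] {w : Fin n → α}
    (hw : Function.Injective w) : ∃ P : Perm (Fin n), ∀ i j, P i < P j ↔ w i < w j := by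
  have hs : StrictMono (w ∘ Tuple.sort w) :=
    (Tuple.monotone_sort w).strictMono_of_injective (hw.comp (Equiv.injective _))
  refine ⟨(Tuple.sort w).symm, fun i j => ?_⟩
  rw [← hs.lt_iff_lt]
  simp

/-- The only order automorphism of `Fin n` is the identity. -/
theorem perm_eq_of_lt_iff {n : ℕ} {P P' : Perm (Fin n)}
    (h : ∀ i j, P i < P j ↔ P' i < P' j) : P = P' := by
  have hs : StrictMono (P.symm.trans P') := fun i j hij => by
    simpa [← h] using hij
  have e : hs.orderIsoOfSurjective _ (Equiv.surjective _) = OrderIso.refl _ :=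
    Subsingleton.elim _ _
  ext i
  simpa using (congrArg Fin.val (DFunLike.congr_fun e (P i))).symm

theorem exists_eq_ominus {a b : ℕ} {p : Perm (Fin (a + b))}
    (h : ∀ i j, p (Fin.natAdd a j) < p (Fin.castAdd b i)) :
    ∃ (P : Perm (Fin a)) (R : Perm (Fin b)), p = ominus P R := by
  obtain ⟨P, hP⟩ := exists_perm_lt_iff (w := fun i => p (Fin.castAdd b i))
    (p.injective.comp (Fin.castAdd_injective a b))
  obtain ⟨R, hR⟩ := exists_perm_lt_iff (w := fun i => p (Fin.natAdd a i))
    (p.injective.comp (Fin.natAdd_injective b a))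
  refine ⟨P, R, perm_eq_of_lt_iff fun i j => ?_⟩
  refine Fin.addCases (fun i => ?_) (fun i => ?_) i <;>
  refine Fin.addCases (fun j => ?_) (fun j => ?_) j
  · exact (hP i j).symm.trans ((isSplit_ominus P R).left i j).symm
  · exact iff_of_false (h i j).not_gt (ominus_lt P R i j).not_gt
  · exact iff_of_true (h j i) (ominus_lt P R j i)
  · exact (hR i j).symm.trans ((isSplit_ominus P R).right i j).symm

theorem exists_eq_oplus {a b : ℕ} {p : Perm (Fin (a + b))}
    (h : ∀ i j, p (Fin.castAdd b i) < p (Fin.natAdd a j)) :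
    ∃ (P : Perm (Fin a)) (R : Perm (Fin b)), p = oplus P R := by
  obtain ⟨P, hP⟩ := exists_perm_lt_iff (w := fun i => p (Fin.castAdd b i))
    (p.injective.comp (Fin.castAdd_injective a b))
  obtain ⟨R, hR⟩ := exists_perm_lt_iff (w := fun i => p (Fin.natAdd a i))
    (p.injective.comp (Fin.natAdd_injective b a))
  refine ⟨P, R, perm_eq_of_lt_iff fun i j => ?_⟩
  refine Fin.addCases (fun i => ?_) (fun i => ?_) i <;>
  refine Fin.addCases (fun j => ?_) (fun j => ?_) j
  · exact (hP i j).symm.trans ((isSplit_oplus P R).left i j).symm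
  · exact iff_of_true (h i j) (lt_oplus P R i j)
  · exact iff_of_false (h j i).not_gt (lt_oplus P R j i).not_gt
  · exact (hR i j).symm.trans ((isSplit_oplus P R).right i j).symm

theorem ominus_injective {a b : ℕ} {P P' : Perm (Fin a)} {R R' : Perm (Fin b)}
    (h : ominus P R = ominus P' R') : P = P' ∧ R = R' := by
  constructor
  · exact perm_eq_of_lt_iff fun i j => by
      rw [← (isSplit_ominus P R).left, ← (isSplit_ominus P' R').left, h]
  · exact perm_eq_of_lt_iff fun i j => by
      rw [← (isSplit_ominus P R).right, ← (isSplit_ominus P' R').right, h]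

theorem oplus_left_injective {a b : ℕ} {P P' : Perm (Fin a)} {R : Perm (Fin b)}
    (h : oplus P R = oplus P' R) : P = P' :=
  perm_eq_of_lt_iff fun i j => by
    rw [← (isSplit_oplus P R).left, ← (isSplit_oplus P' R).left, h]

theorem exists_eq_oplus_incr_one {a : ℕ} {p : Perm (Fin (a + 1))}
    (h : ∀ i, p i ≤ p (Fin.last a)) : ∃ P : Perm (Fin a), p = oplus P (incr 1) := by
  obtain ⟨P, R, rfl⟩ := exists_eq_oplus (a := a) (b := 1) (p := p) fun i j => by
    have hj : Fin.natAdd a j = Fin.last a := by ext; simp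
    rw [hj]
    refine lt_of_le_of_ne (h _) fun e => ?_
    have := congrArg Fin.val (p.injective e)
    simp at this
    omega
  exact ⟨P, by rw [Subsingleton.elim R (incr 1)]⟩

theorem exists_copy_pat132 {n : ℕ} {p : Perm (Fin n)} {i j l : Fin n} (hij : i < j) (hjl : j < l)
    (h1 : p i < p l) (h2 : p l < p j) : ¬ Avoids p pat132 := by
  refine not_not.2 ⟨OrderEmbedding.ofStrictMono ![i, j, l] ?_, ?_⟩
  · intro x y hxy
    fin_cases x <;> fin_cases y <;> simp at hxy ⊢ <;> first | assumption | exact hij.trans hjl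
  · have e0 : pat132 0 = 0 := by decide
    have e1 : pat132 1 = 2 := by decide
    have e2 : pat132 2 = 1 := by decide
    intro x y
    change p (![i, j, l] x) < p (![i, j, l] y) ↔ _
    fin_cases x <;> fin_cases y <;>
      simp [e0, e1, e2, h1, h2, h1.le, h2.le, h1.trans h2, (h1.trans h2).le]

theorem avoids_iff_copies {n k : ℕ} (p : Perm (Fin n)) (r : Perm (Fin k)) :
    Avoids p r ↔ copies p r = 0 := by
  unfold Avoids copies
  rw [Nat.card_eq_zero, or_iff_left (not_infinite_iff_finite.2 inferInstance), isEmpty_subtype,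
    not_exists]

theorem copies_permCongr {n n' k : ℕ} (h : n = n') (p : Perm (Fin n)) (q : Perm (Fin k)) :
    copies ((finCongr h).permCongr p) q = copies p q := by
  subst h; rfl

/-- The permutation `(L ⊕ 1) ⊖ R`, of length `n + 1` when the lengths of `L` and `R` add up
to `n`. -/
def node {a b n : ℕ} (h : a + b = n) (L : Perm (Fin a)) (R : Perm (Fin b)) : Perm (Fin (n + 1)) :=
  (finCongr (by omega : a + 1 + b = n + 1)).permCongr (ominus (oplus L (incr 1)) R)

theorem copies_node {a b n k : ℕ} (h : a + b = n) (L : Perm (Fin a)) (R : Perm (Fin b))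
    (q : Perm (Fin k)) : copies (node h L R) q = copies (ominus (oplus L (incr 1)) R) q :=
  copies_permCongr _ _ _

/-- Since 132 starts below its last entry and does not end in its maximum, its copies in the node
are those in `L` plus those in `R`. -/
theorem avoids_node {a b n : ℕ} (h : a + b = n) (L : Perm (Fin a)) (R : Perm (Fin b)) :
    Avoids (node h L R) pat132 ↔ Avoids L pat132 ∧ Avoids R pat132 := by
  rw [avoids_iff_copies, avoids_iff_copies, avoids_iff_copies, copies_node,
    copies_ominus_of_le (k := 2) _ _ (by decide), copies_oplus_of_lt (k := 2) (i := 1) _ (by decide)]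
  omega

/-- The position of the maximum recovers `a`, which makes the decomposition unique. -/
theorem node_apply_root {a b n : ℕ} (h : a + b = n) (L : Perm (Fin a)) (R : Perm (Fin b)) :
    node h L R ⟨a, by omega⟩ = Fin.last n := by
  subst h
  ext
  have h1 := ominus_left (oplus L (incr 1)) R (Fin.natAdd a 0)
  rw [oplus_right] at h1
  have h2 : Fin.castAdd b (Fin.natAdd a (0 : Fin 1)) = ⟨a, by omega⟩ := rfl
  rw [h2] at h1
  simp only [node, Equiv.permCongr_apply, finCongr_symm, finCongr_apply, Fin.val_cast,
    Fin.cast_mk, h1, Fin.val_last]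
  simp [incr, add_comm]

theorem node_injective {a b a' b' n : ℕ} {h : a + b = n} {h' : a' + b' = n} {L : Perm (Fin a)}
    {R : Perm (Fin b)} {L' : Perm (Fin a')} {R' : Perm (Fin b')}
    (e : node h L R = node h' L' R') :
    (⟨(a, b), L, R⟩ : Σ ab : ℕ × ℕ, Perm (Fin ab.1) × Perm (Fin ab.2)) = ⟨(a', b'), L', R'⟩ := by
  obtain rfl : a = a' := by
    have h1 := node_apply_root h L R
    rw [e, ← node_apply_root h' L' R'] at h1
    exact congrArg Fin.val ((node h' L' R').injective h1)
  obtain rfl : b = b' := by omega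
  obtain ⟨h1, rfl⟩ := ominus_injective ((Equiv.injective _) e)
  rw [oplus_left_injective h1]

theorem exists_node_eq {n : ℕ} {p : Perm (Fin (n + 1))} (hp : Avoids p pat132) :
    ∃ (a b : ℕ) (h : a + b = n) (L : Perm (Fin a)) (R : Perm (Fin b)), node h L R = p := by
  obtain ⟨r, hr⟩ := p.surjective (Fin.last n)
  have hmax : ∀ i, p i ≤ p r := fun i => hr ▸ Fin.le_last _
  have hlt : ∀ i, i ≠ r → p i < p r := fun i hi =>
    lt_of_le_of_ne (hmax i) (p.injective.ne hi)
  obtain ⟨b, hb⟩ : ∃ b, (r : ℕ) + b = n := ⟨n - r, by omega⟩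
  have h' : n + 1 = r + 1 + b := by omega
  obtain ⟨P, R, hPR⟩ := exists_eq_ominus (a := r + 1) (b := b)
    (p := (finCongr h').permCongr p) fun i j => by
      have hj : r < Fin.cast h'.symm (Fin.natAdd (r + 1) j) := by
        simp only [Fin.lt_def, Fin.val_cast, Fin.val_natAdd]; omega
      simp only [Equiv.permCongr_apply, finCongr_symm, finCongr_apply, Fin.cast_lt_cast]
      rcases (Nat.lt_succ_iff.1 i.2).eq_or_lt with hi | hi
      · rw [show Fin.cast h'.symm (Fin.castAdd b i) = r from Fin.ext hi]
        exact hlt _ hj.ne'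
      -- Otherwise the entry before `r`, the maximum at `r` and the entry after it form a 132.
      · by_contra hn
        refine exists_copy_pat132 (i := Fin.cast h'.symm (Fin.castAdd b i)) (j := r)
          (Fin.lt_def.2 hi) hj (lt_of_le_of_ne (not_lt.1 hn) ?_) (hlt _ hj.ne') hp
        refine p.injective.ne (Fin.ne_of_lt ?_)
        exact lt_trans (Fin.lt_def.2 hi) hj
  obtain ⟨L, rfl⟩ := exists_eq_oplus_incr_one (p := P) fun i => by
    rw [← not_lt, ← (isSplit_ominus P R).left, ← hPR, not_lt]
    simp only [Equiv.permCongr_apply, finCongr_symm, finCongr_apply, Fin.cast_le_cast]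
    exact hmax _
  refine ⟨r, b, hb, L, R, ?_⟩
  unfold node
  rw [← hPR]
  ext i
  simp

/-! ### Recurrence for the total counts -/

open Classical in
/-- The `132`-avoiding permutations of length `n`. -/
noncomputable def avoiders (n : ℕ) : Finset (Perm (Fin n)) :=
  Finset.univ.filter fun p => Avoids p pat132

theorem S_pat132 (n : ℕ) {k : ℕ} (Q : Perm (Fin k)) :
    S n pat132 Q = ∑ p ∈ avoiders n, copies p Q := rfl

theorem mem_avoiders {n : ℕ} {p : Perm (Fin n)} : p ∈ avoiders n ↔ Avoids p pat132 := by
  simp [avoiders]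

theorem S_succ (n : ℕ) {k : ℕ} (Q : Perm (Fin k)) :
    S (n + 1) pat132 Q = ∑ ab ∈ Finset.HasAntidiagonal.antidiagonal n, ∑ L ∈ avoiders ab.1,
      ∑ R ∈ avoiders ab.2, copies (ominus (oplus L (incr 1)) R) Q := by
  simp_rw [← Finset.sum_product']
  rw [Finset.sum_sigma', S_pat132]
  symm
  refine Finset.sum_bij
    (fun x hx => node (Finset.HasAntidiagonal.mem_antidiagonal.1 (Finset.mem_sigma.1 hx).1) x.2.1 x.2.2)
    ?_ ?_ ?_ ?_
  · rintro ⟨⟨a, b⟩, L, R⟩ hx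
    rw [mem_avoiders, avoids_node]
    simpa [mem_avoiders] using (Finset.mem_sigma.1 hx).2
  · rintro ⟨⟨a, b⟩, L, R⟩ hx ⟨⟨a', b'⟩, L', R'⟩ hx' e
    exact node_injective e
  · intro p hp
    obtain ⟨a, b, h, L, R, rfl⟩ := exists_node_eq (mem_avoiders.1 hp)
    refine ⟨⟨(a, b), L, R⟩, ?_, rfl⟩
    rw [mem_avoiders, avoids_node] at hp
    simp [mem_avoiders, h, hp]
  · rintro ⟨⟨a, b⟩, L, R⟩ hx
    rw [copies_node]

theorem S_zero_of_pos {k : ℕ} (Q : Perm (Fin (k + 1))) : S 0 pat132 Q = 0 := by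
  rw [S_pat132]
  refine Finset.sum_eq_zero fun p _ => ?_
  unfold copies
  rw [Nat.card_eq_zero]
  exact Or.inl ⟨fun f => (f.1 0).elim0⟩

theorem S_empty (n : ℕ) : S n pat132 (incr 0) = (avoiders n).card := by
  simp [S_pat132, copies_zero]

theorem S_zero_empty : S 0 pat132 (incr 0) = 1 := by
  rw [S_empty, Finset.card_eq_one]
  refine ⟨Equiv.refl _, ?_⟩
  ext p
  simp only [mem_avoiders, Finset.mem_singleton, Subsingleton.elim p (Equiv.refl _), iff_true]
  rintro ⟨f, -⟩
  exact (f 0).elim0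

/-! ### Generating function equations -/

open PowerSeries

/-- The generating function of the numbers `S n pat132 Q`. -/
noncomputable def genFun {k : ℕ} (Q : Perm (Fin k)) : PowerSeries ℤ :=
  PowerSeries.mk fun n => (S n pat132 Q : ℤ)

/-- The generating function of the numbers of `132`-avoiding permutations. -/
noncomputable def avoidersGenFun : PowerSeries ℤ := genFun (incr 0)

local notation "𝒞" => avoidersGenFun

theorem coeff_genFun (n : ℕ) {k : ℕ} (Q : Perm (Fin k)) : coeff n (genFun Q) = S n pat132 Q := by
  simp [genFun]

theorem avoidersGenFun_eq : 𝒞 = 1 + X * (𝒞 * 𝒞) := by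
  ext n
  unfold avoidersGenFun
  cases n with
  | zero => simp [S_zero_empty, genFun]
  | succ n =>
    rw [map_add, coeff_succ_X_mul, coeff_mul, coeff_genFun, S_succ]
    simp [coeff_one, coeff_genFun, S_empty, copies_zero]

theorem oplus_one_zero_le_last {k : ℕ} (Q : Perm (Fin k)) :
    oplus Q (incr 1) 0 ≤ oplus Q (incr 1) (Fin.last k) := by
  rcases Nat.eq_zero_or_pos k with rfl | hk
  · exact le_of_eq (congrArg _ (Subsingleton.elim (α := Fin 1) _ _))
  · exact (lt_oplus_of_lt_of_le Q (incr 1) (by simpa using hk) (by simp)).le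

theorem genFun_oplus_one {k : ℕ} (Q : Perm (Fin k)) :
    genFun (oplus Q (incr 1)) =
      X * ((genFun (oplus Q (incr 1)) + genFun Q) * 𝒞 + 𝒞 * genFun (oplus Q (incr 1))) := by
  ext n
  unfold avoidersGenFun
  cases n with
  | zero => simp [S_zero_of_pos, genFun]
  | succ n =>
    rw [coeff_succ_X_mul, coeff_genFun, S_succ]
    simp only [map_add, coeff_mul, coeff_genFun, S_empty, copies_ominus_of_le _ _ (oplus_one_zero_le_last Q), copies_oplus_oplus, ← Finset.sum_add_distrib]
    push_cast
    refine Finset.sum_congr rfl fun ab _ => ?_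
    simp only [S_pat132, Finset.sum_add_distrib, Finset.sum_const, ← Finset.mul_sum,
      nsmul_eq_mul]
    push_cast
    ring

/-- The pattern ends below its first entry, so the maximum of `L ⊕ 1` adds no copy within `L ⊕ 1`.
The product term counts copies with the first block in `L ⊕ 1` and the second in `R`. -/
theorem genFun_ominus {k m : ℕ} (q : Perm (Fin k)) (t : Perm (Fin m)) :
    genFun (ominus (oplus q (incr 1)) (oplus t (incr 1))) =
      X * (genFun (ominus (oplus q (incr 1)) (oplus t (incr 1))) * 𝒞 +
        𝒞 * genFun (ominus (oplus q (incr 1)) (oplus t (incr 1))) +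
        (genFun (oplus q (incr 1)) + genFun q) * genFun (oplus t (incr 1))) := by
  have hlt : ominus (oplus q (incr 1)) (oplus t (incr 1)) (Fin.last (k + 1 + m)) <
      ominus (oplus q (incr 1)) (oplus t (incr 1)) 0 :=
    ominus_lt_of_lt_of_le _ _ (by simp) (by simp)
  ext n
  unfold avoidersGenFun
  cases n with
  | zero =>
    rw [coeff_genFun]
    refine (congrArg Nat.cast (S_zero_of_pos (k := k + 1 + m) _)).trans ?_
    simp
  | succ n =>
    rw [coeff_succ_X_mul, coeff_genFun, S_succ]
    simp only [map_add, coeff_mul, coeff_genFun, S_empty, copies_ominus_ominus _ _ (oplus_one_zero_le_last q)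
        (oplus_one_zero_le_last t), copies_oplus_oplus,
      copies_oplus_of_lt (k := k + 1 + m) _ hlt, ← Finset.sum_add_distrib]
    push_cast
    refine Finset.sum_congr rfl fun ab _ => ?_
    simp only [S_pat132, Finset.sum_add_distrib, Finset.sum_const, ← Finset.mul_sum,
      nsmul_eq_mul, ← Finset.sum_mul]
    push_cast
    ring

/-! ### Solving the equations -/

theorem oplus_incr_succ {k : ℕ} (Q : Perm (Fin k)) (u : ℕ) :
    oplus Q (incr (u + 1)) = oplus (oplus Q (incr u)) (incr 1) := by
  refine perm_eq_of_lt_iff (n := k + (u + 1)) fun i j => ?_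
  have h1 : ∀ i, (oplus Q (incr (u + 1)) i : ℕ) =
      (oplus (oplus Q (incr u)) (incr 1) : Perm (Fin (k + u + 1))) i := by
    intro i
    refine Fin.addCases (fun i => ?_) (fun i => ?_) i
    · rw [oplus_left]
      exact ((oplus_left _ (incr 1) (Fin.castAdd u i)).trans (oplus_left Q (incr u) i)).symm
    · rw [oplus_right]
      refine Fin.lastCases ?_ (fun i => ?_) i
      · refine Eq.symm ((oplus_right (oplus Q (incr u)) (incr 1) 0).trans ?_)
        simp [incr, add_comm]
      · exact ((oplus_left _ (incr 1) (Fin.natAdd k i)).trans (oplus_right Q (incr u) i)).symm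
  rw [Fin.lt_def, Fin.lt_def, h1, h1]

theorem oplus_incr_zero {k : ℕ} (Q : Perm (Fin k)) : oplus Q (incr 0) = Q := by
  refine perm_eq_of_lt_iff (n := k) fun i j => ?_
  exact (isSplit_oplus Q (incr 0)).left i j

theorem genFun_oplus_incr {k : ℕ} (Q : Perm (Fin k)) (u : ℕ) :
    (1 - 2 * X * 𝒞) ^ u * genFun (oplus Q (incr u)) = (X * 𝒞) ^ u * genFun Q := by
  induction u with
  | zero => simp only [pow_zero, one_mul]; exact congrArg genFun (oplus_incr_zero Q)
  | succ u ih =>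
    have h := genFun_oplus_one (oplus Q (incr u))
    have e : genFun (oplus Q (incr (u + 1))) = genFun (oplus (oplus Q (incr u)) (incr 1)) :=
      congrArg (genFun (k := k + u + 1)) (oplus_incr_succ Q u)
    rw [e]
    linear_combination (1 - 2 * X * 𝒞) ^ u * h + X * 𝒞 * ih

theorem genFun_ominus_eq_mul {k m : ℕ} (hk : 0 < k) (hm : 0 < m) {q : Perm (Fin k)}
    {t : Perm (Fin m)} (hq : EndsInLargest q) (ht : EndsInLargest t) :
    𝒞 ^ 2 * (1 - 2 * X * 𝒞) * genFun (ominus q t) = genFun q * genFun t := by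
  obtain ⟨k, rfl⟩ := Nat.exists_eq_succ_of_ne_zero hk.ne'
  obtain ⟨m, rfl⟩ := Nat.exists_eq_succ_of_ne_zero hm.ne'
  obtain ⟨q, rfl⟩ := exists_eq_oplus_incr_one (hq (Fin.last k) rfl)
  obtain ⟨t, rfl⟩ := exists_eq_oplus_incr_one (ht (Fin.last m) rfl)
  have h1 := genFun_oplus_one q
  have h2 := genFun_ominus q t
  have h3 := avoidersGenFun_eq
  -- With q the shortened pattern, `h1` reads XC(F(q ⊕ 1) + F(q)) = (1 - XC) F(q ⊕ 1). Since C(1 -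
  -- XC) = 1 by `h3`, the sum in `h2` times XC² is just F(q ⊕ 1).
  linear_combination 𝒞 ^ 2 * h2 - 𝒞 * genFun (oplus t (incr 1)) * h1 +
    genFun (oplus q (incr 1)) * genFun (oplus t (incr 1)) * h3

theorem EndsInLargest.oplus_incr {k : ℕ} {q : Perm (Fin k)} (hq : EndsInLargest q) (u : ℕ) :
    EndsInLargest (oplus q (incr u)) := by
  cases u with
  | zero => rw [oplus_incr_zero]; exact hq
  | succ u =>
    intro i hi j
    obtain rfl : i = Fin.natAdd k (Fin.last u) := by
      ext
      rw [Fin.val_natAdd, Fin.val_last]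
      omega
    refine Fin.addCases (fun j => (lt_oplus q _ j _).le) (fun j => ?_) j
    rw [Fin.le_def, oplus_right, oplus_right]
    exact Nat.add_le_add_right (Fin.le_last j) k

theorem genFun_ominus_oplus_incr {k m : ℕ} (hk : 0 < k) (hm : 0 < m) {q : Perm (Fin k)}
    {t : Perm (Fin m)} (hq : EndsInLargest q) (ht : EndsInLargest t) (u : ℕ) :
    genFun (oplus (ominus q t) (incr u)) = genFun (ominus (oplus q (incr u)) t) := by
  have hC : constantCoeff 𝒞 = 1 := by rw [avoidersGenFun_eq]; simp
  -- The factor has constant coefficient 1.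
  have hne : 𝒞 ^ 2 * (1 - 2 * X * 𝒞) * (1 - 2 * X * 𝒞) ^ u ≠ 0 := fun e => by
    have := congrArg constantCoeff e
    simp [hC] at this
  refine mul_left_cancel₀ hne ?_
  have h1 := genFun_ominus_eq_mul hk hm hq ht
  have h2 := genFun_ominus_eq_mul (Nat.add_pos_left hk u) hm (hq.oplus_incr u) ht
  have h3 := genFun_oplus_incr (ominus q t) u
  have h4 := genFun_oplus_incr q u
  linear_combination 𝒞 ^ 2 * (1 - 2 * X * 𝒞) * h3 + (X * 𝒞) ^ u * h1 -
    (1 - 2 * X * 𝒞) ^ u * h2 - genFun t * h4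

end PatternCount

theorem theorem4p1 {k m : ℕ} (hk : 0 < k) (hm : 0 < m)
    (q : Equiv.Perm (Fin k)) (t : Equiv.Perm (Fin m))
    (hq : PatternCount.EndsInLargest q) (ht : PatternCount.EndsInLargest t) (u n : ℕ) :
    PatternCount.S n PatternCount.pat132
        (PatternCount.oplus (PatternCount.ominus q t) (PatternCount.incr u)) =
      PatternCount.S n PatternCount.pat132
        (PatternCount.ominus (PatternCount.oplus q (PatternCount.incr u)) t) := by
  have h := congrArg (PowerSeries.coeff n)
    (PatternCount.genFun_ominus_oplus_incr hk hm hq ht u)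
  rw [PatternCount.coeff_genFun, PatternCount.coeff_genFun] at h
  exact_mod_cast h
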